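/- All vector spaces are over $\mathbb{C}$. An inductive spectrum of Banach spaces is a sequence $\mathscr{Z} = (Z_n)_{n \in \mathbb{N}}$ of Banach spaces with $Z_n \subseteq Z_{n+1}$ and continuous inclusion maps; its inductive limit $\operatorname{Ind} \mathscr{Z}$ is $\bigcup_{n} Z_n$ with the finest locally convex topology such that all inclusion maps $Z_n \to \bigcup_n Z_n$ are continuous. An $(LB)$-space is a Hausdorff locally convex space $Z$ of the form $Z = \operatorname{Ind} \mathscr{Z}$ for some such $\mathscr{Z}$. Consider the map $d : \bigoplus_{n} Z_n \to \bigoplus_{n} Z_n$, $d((x_n)_n) = (x_n - x_{n-1})_n$, where the term $x_{n-1}$ is read as $0$ for the first index $n$, on the locally convex direct sum. The $(LB)$-space $Z = \operatorname{Ind} \mathscr{Z}$ is called acyclic (respectively, weakly acyclic) if $d$ is a topological embedding (respectively, a topological embedding for the weak topologies on domain and codomain). For a Hausdorff locally convex space $E$, an $(LB)$-space $Z$ is called weakly $E$-acyclic if for every algebraically exact sequence $0 \to X \xrightarrow{\iota} Y \xrightarrow{Q} Z \to 0$ of $(LB)$-spaces and continuous linear maps, the map $L(Y,E) \to L(X,E)$,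 $T \mapsto T \circ \iota$, between the spaces of continuous linear maps is surjective. **Proposition.** Let $Z$ be an $(LB)$-space and let $\mathscr{Z}$ be any inductive spectrum of Banach spaces with $Z = \operatorname{Ind} \mathscr{Z}$, through which (weak) acyclicity of $Z$ is defined. Then: (i) $Z$ is acyclic if and only if $Z$ is weakly $\ell^\infty(I)$-acyclic for every index set $I$. (ii) $Z$ is weakly acyclic if and only if $Z$ is weakly $\ell^\infty(I)$-acyclic for every finite index set $I$, and this holds if and only if $Z$ is weakly $\ell^\infty(I)$-acyclic for some non-empty finite index set $I$. -/

import Mathlib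

open scoped DirectSum ENNReal

universe u v w

noncomputable section

/-- The finest locally convex vector space topology on the complex vector space `V` for which all
the linear maps `j i : F i → V` are continuous. (In Mathlib's order on topologies, smaller means
finer; `finestLCTopology_isLeast` shows that the infimum is attained.) -/
@[reducible] def finestLCTopology {ι : Type w} {V : Type u} [AddCommGroup V] [Module ℂ V]
    {F : ι → Type v} [∀ i, AddCommGroup (F i)] [∀ i, Module ℂ (F i)]
    [∀ i, TopologicalSpace (F i)] (j : ∀ i, F i →ₗ[ℂ] V) : TopologicalSpace V :=
  sInf {t | @IsTopologicalAddGroup V t _ ∧ @ContinuousSMul ℂ V _ _ t ∧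
    @LocallyConvexSpace ℝ V _ _ _ _ t ∧ ∀ i, @Continuous _ _ _ t (j i)}

theorem finestLCTopology_isLeast {ι : Type w} {V : Type u} [AddCommGroup V] [Module ℂ V]
    {F : ι → Type v} [∀ i, AddCommGroup (F i)] [∀ i, Module ℂ (F i)]
    [∀ i, TopologicalSpace (F i)] (j : ∀ i, F i →ₗ[ℂ] V) :
    IsLeast {t | @IsTopologicalAddGroup V t _ ∧ @ContinuousSMul ℂ V _ _ t ∧
      @LocallyConvexSpace ℝ V _ _ _ _ t ∧ ∀ i, @Continuous _ _ _ t (j i)}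
      (finestLCTopology j) := by
  refine ⟨⟨?_, ?_, ?_, fun i => ?_⟩, fun t ht => sInf_le ht⟩
  · exact topologicalAddGroup_sInf fun t ht => ht.1
  · exact continuousSMul_sInf fun t ht => ht.2.1
  · exact LocallyConvexSpace.sInf fun t ht => ht.2.2.1
  · exact continuous_sInf_rng.2 fun t ht => ht.2.2.2 i

/-- An inductive spectrum of Banach spaces `X₀ ⊆ X₁ ⊆ X₂ ⊆ ⋯` with continuous inclusions whose
union is the vector space `X`. The subspace `Xₙ` of `X`, which carries its own Banach space norm,
is given as the type `space n` together with the injective linear map `incl n` into `X`; the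
inclusion `Xₙ ⊆ Xₙ₊₁` is the continuous linear map `link n`. -/
structure BanachSpectrum (X : Type u) [AddCommGroup X] [Module ℂ X] where
  space : ℕ → Type u
  [normedAddCommGroup : ∀ n, NormedAddCommGroup (space n)]
  [normedSpace : ∀ n, NormedSpace ℂ (space n)]
  [completeSpace : ∀ n, CompleteSpace (space n)]
  incl : ∀ n, space n →ₗ[ℂ] X
  incl_injective : ∀ n, Function.Injective (incl n)
  link : ∀ n, space n →L[ℂ] space (n + 1)
  incl_link : ∀ n (x : space n), incl (n + 1) (link n x) = incl n x
  exists_incl_eq : ∀ x : X, ∃ n, ∃ y : space n, incl n y = x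

namespace BanachSpectrum

attribute [instance] normedAddCommGroup normedSpace completeSpace

section

variable {X : Type u} [AddCommGroup X] [Module ℂ X] (S : BanachSpectrum X)

/-- The given topology of `X` is the inductive limit topology of the spectrum: `X = Ind S`. -/
def IsInd [t : TopologicalSpace X] : Prop :=
  t = finestLCTopology S.incl

/-- The direct sum `⨁ₙ Xₙ` of the steps of the spectrum. -/
def DSum : Type u := ⨁ n, S.space n

instance : AddCommGroup S.DSum := inferInstanceAs (AddCommGroup (⨁ n, S.space n))

instance : Module ℂ S.DSum := inferInstanceAs (Module ℂ (⨁ n, S.space n))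

/-- The embedding of the `n`-th summand. -/
def single (n : ℕ) : S.space n →ₗ[ℂ] S.DSum :=
  DirectSum.lof ℂ ℕ S.space n

/-- The `n`-th coordinate of an element of the direct sum. -/
def coord (n : ℕ) : S.DSum →ₗ[ℂ] S.space n :=
  DirectSum.component ℂ ℕ S.space n

/-- The locally convex direct sum topology. -/
instance : TopologicalSpace S.DSum := finestLCTopology S.single

/-- The right shift `(x₀, x₁, x₂, …) ↦ (0, x₀, x₁, …)`. -/
def shift : S.DSum →ₗ[ℂ] S.DSum :=
  DirectSum.toModule ℂ ℕ S.DSum fun n => S.single (n + 1) ∘ₗ (S.link n : S.space n →ₗ[ℂ] _)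

/-- The map `d : (xₙ)ₙ ↦ (xₙ - xₙ₋₁)ₙ`, where `x₋₁ = 0`. -/
def d : S.DSum →ₗ[ℂ] S.DSum :=
  LinearMap.id - S.shift

theorem shift_single (n : ℕ) (y : S.space n) :
    S.shift (S.single n y) = S.single (n + 1) (S.link n y) :=
  DirectSum.toModule_lof ℂ n y

theorem coord_single_self (n : ℕ) (y : S.space n) : S.coord n (S.single n y) = y :=
  DirectSum.component.lof_self ℂ n y

theorem coord_single_of_ne {m n : ℕ} (h : m ≠ n) (y : S.space m) :
    S.coord n (S.single m y) = 0 :=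
  (DirectSum.component.of ℂ n m y).trans (dif_neg h)

theorem hom_ext {V : Type v} [AddCommGroup V] [Module ℂ V] {f g : S.DSum →ₗ[ℂ] V}
    (h : ∀ n y, f (S.single n y) = g (S.single n y)) : f = g :=
  DirectSum.linearMap_ext ℂ fun n => LinearMap.ext (h n)

theorem coord_zero_d (x : S.DSum) : S.coord 0 (S.d x) = S.coord 0 x := by
  have h : S.coord 0 ∘ₗ S.shift = 0 := S.hom_ext fun m y => by
    simp [shift_single, coord_single_of_ne]
  have hx := LinearMap.congr_fun h x
  simp only [LinearMap.comp_apply, LinearMap.zero_apply] at hx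
  simp [d, hx]

theorem coord_succ_d (x : S.DSum) (n : ℕ) :
    S.coord (n + 1) (S.d x) = S.coord (n + 1) x - S.link n (S.coord n x) := by
  have h : S.coord (n + 1) ∘ₗ S.shift = (S.link n : S.space n →ₗ[ℂ] _) ∘ₗ S.coord n :=
    S.hom_ext fun m y => by
      by_cases hmn : m = n
      · subst hmn
        simp [shift_single, coord_single_self]
      · simp [shift_single, coord_single_of_ne, hmn]
  have hx := LinearMap.congr_fun h x
  simp only [LinearMap.comp_apply, ContinuousLinearMap.coe_coe] at hx
  simp [d, hx]

/-- The spectrum is acyclic: `d` is a topological embedding. -/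
def IsAcyclic : Prop :=
  Topology.IsEmbedding S.d

/-- The spectrum is weakly acyclic: `d` is a topological embedding for the weak topologies. -/
def IsWeaklyAcyclic : Prop :=
  Topology.IsEmbedding fun x : WeakSpace ℂ S.DSum =>
    toWeakSpace ℂ S.DSum (S.d ((toWeakSpace ℂ S.DSum).symm x))

end

end BanachSpectrum

/-- An (LB)-space: a Hausdorff space that is the inductive limit of an inductive spectrum of Banach
spaces. (The compatibility of the topology with the vector space structure and its local convexity
follow from `BanachSpectrum.IsInd`.) -/
def IsLBSpace (X : Type u) [AddCommGroup X] [Module ℂ X] [TopologicalSpace X] : Prop :=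
  T2Space X ∧ ∃ S : BanachSpectrum X, S.IsInd

/-- The space `Z` is weakly `E`-acyclic: for every exact sequence `0 → X → Y → Z → 0` of
(LB)-spaces, with maps `i : X → Y` and `Q : Y → Z`, the map `L(Y, E) → L(X, E)`, `T ↦ T ∘ i`, is
surjective. -/
def IsWeaklyAcyclicWrt (E : Type v) [AddCommGroup E] [Module ℂ E] [TopologicalSpace E]
    (Z : Type u) [AddCommGroup Z] [Module ℂ Z] [TopologicalSpace Z] : Prop :=
  ∀ (X Y : Type u) [AddCommGroup X] [Module ℂ X] [TopologicalSpace X]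
    [AddCommGroup Y] [Module ℂ Y] [TopologicalSpace Y],
    IsLBSpace X → IsLBSpace Y →
    ∀ (i : X →L[ℂ] Y) (Q : Y →L[ℂ] Z),
      Function.Injective i → Function.Exact i Q → Function.Surjective Q →
      Function.Surjective fun T : Y →L[ℂ] E => T.comp i

/-- The Banach space `ℓ^∞(I)` of bounded complex families indexed by `I`, with the supremum
norm. -/
abbrev EllInfty (I : Type u) : Type u := lp (fun _ : I => ℂ) ∞

end

/-! Everything passes through one condition, `DFactors E`: each continuous linear map from the
direct sum to `E` has the form `R ∘ d`. On the summands this reads `T_n = R_n - R_{n+1}|Z_n`, the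
vanishing of the first derived projective limit of the spaces `L(Z_n, E)`.

By Hahn-Banach in each coordinate, and because continuous seminorms are norms of maps into some
`ℓ^∞(I)`, `d` is an embedding iff `DFactors` holds for all `ℓ^∞(I)`. For finite non-empty `I` only
functionals matter, and the condition describes weak embeddings.

Weak `E`-acyclicity gives `DFactors E` when applied to the canonical resolution of `Z` by two copies
of the direct sum, with maps `d` and summation. Conversely, for an exact sequence `X → Y → Z` and
`T` on `X`, injectivity of `ℓ^∞(I)` yields extensions `U_n` on the steps `Y_n`. They differ from a
merely algebraic extension `T'` by maps `A_n ∘ Q`. After reindexing by Grothendieck factorization,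
`DFactors` supplies `B` such that `A_n - B` is continuous on the steps, and `T' + B ∘ Q` is the
required extension. -/

/-! ### Open mapping and Grothendieck factorization -/

open Filter Topology Metric in
/-- Banach's open mapping theorem combined with Baire's theorem: if the ranges of countably many
continuous linear maps between Banach spaces cover the codomain, then one of the maps is onto, with
norm control of the preimages. -/
theorem exists_preimage_norm_le_of_cover {F : Type u} [NormedAddCommGroup F] [NormedSpace ℂ F]
    [CompleteSpace F] {H : ℕ → Type v} [∀ k, NormedAddCommGroup (H k)] [∀ k, NormedSpace ℂ (H k)]
    [∀ k, CompleteSpace (H k)] (p : ∀ k, H k →L[ℂ] F) (hp : ∀ y, ∃ k x, p k x = y) :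
    ∃ (k : ℕ) (C : ℝ), ∀ y, ∃ x, p k x = y ∧ ‖x‖ ≤ C * ‖y‖ := by
  have hcover : ⋃ kn : ℕ × ℕ, closure (p kn.1 '' ball 0 kn.2) = Set.univ := by
    refine Set.eq_univ_of_forall fun y => ?_
    obtain ⟨k, x, rfl⟩ := hp y
    obtain ⟨n, hn⟩ := exists_nat_gt ‖x‖
    exact Set.mem_iUnion.2 ⟨(k, n), subset_closure ⟨x, by simpa using hn, rfl⟩⟩
  obtain ⟨⟨k, n⟩, a, ha⟩ := nonempty_interior_of_iUnion_of_closed (fun _ => isClosed_closure) hcover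
  simp only [mem_interior_iff_mem_nhds, Metric.mem_nhds_iff] at ha
  obtain ⟨ε, hε, H⟩ := ha
  -- Scale `y` to norm `ε / 2` and approximate both `a + t y` and `a` up to `ε / 8`; the difference
  -- of the approximants, scaled back by `2‖y‖ / ε`, misses `y` by at most `‖y‖ / 2`.
  have happrox : ∀ y, ∃ x, ‖y - p k x‖ ≤ 1 / 2 * ‖y‖ ∧ ‖x‖ ≤ 4 * n / ε * ‖y‖ := by
    intro y
    rcases eq_or_ne y 0 with rfl | hy
    · exact ⟨0, by simp⟩
    have hy' : 0 < ‖y‖ := norm_pos_iff.2 hy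
    set t : ℝ := ε / (2 * ‖y‖) with ht
    have ht0 : 0 < t := by positivity
    have hty : ‖(t : ℂ) • y‖ = ε / 2 := by
      rw [norm_smul, Complex.norm_real, Real.norm_of_nonneg ht0.le, ht]
      field_simp
    have h1 : a + (t : ℂ) • y ∈ ball a ε := by
      rw [mem_ball, dist_eq_norm, add_sub_cancel_left, hty]
      linarith
    obtain ⟨_, ⟨x₁, hx₁, rfl⟩, hd₁⟩ := Metric.mem_closure_iff.1 (H h1) (ε / 8) (by positivity)
    obtain ⟨_, ⟨x₂, hx₂, rfl⟩, hd₂⟩ :=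
      Metric.mem_closure_iff.1 (H (mem_ball_self hε)) (ε / 8) (by positivity)
    rw [mem_ball, dist_zero_right] at hx₁ hx₂
    rw [dist_eq_norm] at hd₁ hd₂
    have hyeq : y = (t : ℂ)⁻¹ • (t : ℂ) • y :=
      (inv_smul_smul₀ (Complex.ofReal_ne_zero.2 ht0.ne') y).symm
    have hnt : ‖((t : ℂ)⁻¹)‖ = 2 * ‖y‖ / ε := by
      rw [norm_inv, Complex.norm_real, Real.norm_of_nonneg ht0.le, ht, inv_div]
    refine ⟨(t : ℂ)⁻¹ • (x₁ - x₂), ?_, ?_⟩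
    · have h2 : y - p k ((t : ℂ)⁻¹ • (x₁ - x₂)) =
          (t : ℂ)⁻¹ • ((a + (t : ℂ) • y - p k x₁) - (a - p k x₂)) := by
        rw [map_smul, map_sub]
        nth_rewrite 1 [hyeq]
        rw [← smul_sub]
        congr 1
        abel
      rw [h2, norm_smul, hnt]
      calc 2 * ‖y‖ / ε * ‖(a + (t : ℂ) • y - p k x₁) - (a - p k x₂)‖
          ≤ 2 * ‖y‖ / ε * (ε / 8 + ε / 8) := by
            gcongr
            exact (norm_sub_le _ _).trans (by gcongr)
        _ = 1 / 2 * ‖y‖ := by field_simp; ring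
    · rw [norm_smul, hnt]
      calc 2 * ‖y‖ / ε * ‖x₁ - x₂‖ ≤ 2 * ‖y‖ / ε * (n + n) := by
            gcongr
            exact (norm_sub_le _ _).trans (by gcongr)
        _ = 4 * n / ε * ‖y‖ := by ring
  choose g hg₁ hg₂ using happrox
  refine ⟨k, 2 * (4 * n / ε), fun y => ?_⟩
  -- Iterating the residual halves it each time, so the corrections form a geometric series; its sum
  -- produces the factor 2.
  let h : F → F := fun z => z - p k (g z)
  have hle : ∀ m, ‖h^[m] y‖ ≤ (1 / 2) ^ m * ‖y‖ := fun m => by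
    induction m with
    | zero => simp
    | succ m ih =>
      rw [Function.iterate_succ_apply', pow_succ', mul_assoc]
      exact (hg₁ _).trans (by gcongr)
  have ule : ∀ m, ‖g (h^[m] y)‖ ≤ (1 / 2) ^ m * (4 * n / ε * ‖y‖) := fun m =>
    (hg₂ _).trans <| by
      rw [mul_left_comm]
      gcongr
      exact hle m
  have hs : Summable fun m => (1 / 2 : ℝ) ^ m * (4 * n / ε * ‖y‖) :=
    summable_geometric_two.mul_right _
  have su : Summable fun m => g (h^[m] y) := hs.of_norm_bounded ule
  refine ⟨∑' m, g (h^[m] y), ?_, ?_⟩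
  · have hsum : ∀ m, p k (∑ i ∈ Finset.range m, g (h^[i] y)) = y - h^[m] y := fun m => by
      induction m with
      | zero => simp
      | succ m ih =>
        rw [Finset.sum_range_succ, map_add, ih, Function.iterate_succ_apply']
        simp only [h]
        abel
    have L₁ := ((p k).continuous.tendsto _).comp su.hasSum.tendsto_sum_nat
    have L₂ : Tendsto (fun m => y - h^[m] y) atTop (𝓝 (y - 0)) := by
      refine tendsto_const_nhds.sub (squeeze_zero_norm hle ?_)
      rw [← zero_mul ‖y‖]
      exact (tendsto_pow_atTop_nhds_zero_of_lt_one (by norm_num) (by norm_num)).mul_const _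
    rw [sub_zero] at L₂
    exact tendsto_nhds_unique L₁ (L₂.congr fun m => (hsum m).symm)
  · refine (tsum_of_norm_bounded hs.hasSum ule).trans (le_of_eq ?_)
    rw [tsum_mul_right, tsum_geometric_two]
    ring

/-- A form of Grothendieck's factorization theorem: if a Banach space and countably many Banach
spaces are mapped into a Hausdorff space and the ranges of the latter cover that of the former, then
one of them suffices, with norm control. -/
theorem exists_lift_norm_le {V : Type w} [AddCommGroup V] [Module ℂ V] [TopologicalSpace V]
    [T2Space V] {F : Type u} [NormedAddCommGroup F] [NormedSpace ℂ F] [CompleteSpace F]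
    {G : ℕ → Type v} [∀ k, NormedAddCommGroup (G k)] [∀ k, NormedSpace ℂ (G k)]
    [∀ k, CompleteSpace (G k)] {a : F →ₗ[ℂ] V} (ha : Continuous a) {b : ∀ k, G k →ₗ[ℂ] V}
    (hb : ∀ k, Continuous (b k)) (h : ∀ f, ∃ k g, b k g = a f) :
    ∃ (k : ℕ) (C : ℝ), ∀ f, ∃ g, b k g = a f ∧ ‖g‖ ≤ C * ‖f‖ := by
  -- The fibre product of `a` and `b k` is a Banach space because `V` is Hausdorff, and its
  -- projections to `F` have ranges covering `F`.
  let H : ∀ k, Submodule ℂ (F × G k) := fun k =>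
    LinearMap.eqLocus (a ∘ₗ LinearMap.fst ℂ F (G k)) (b k ∘ₗ LinearMap.snd ℂ F (G k))
  have hH : ∀ k, IsClosed (H k : Set (F × G k)) := fun k =>
    isClosed_eq (ha.comp continuous_fst) ((hb k).comp continuous_snd)
  have : ∀ k, CompleteSpace (H k) := fun k => (hH k).completeSpace_coe
  obtain ⟨k, C, hC⟩ := exists_preimage_norm_le_of_cover
    (fun k => (ContinuousLinearMap.fst ℂ F (G k)).comp (H k).subtypeL) fun f => by
      obtain ⟨k, g, hg⟩ := h f
      exact ⟨k, ⟨(f, g), hg.symm⟩, rfl⟩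
  refine ⟨k, C, fun f => ?_⟩
  obtain ⟨⟨⟨f', g⟩, hfg⟩, rfl, hx⟩ := hC f
  exact ⟨g, Eq.symm hfg, (le_max_right _ _).trans hx⟩

/-- In the situation of the factorization theorem, continuity of a linear map on one of the covering
Banach spaces implies its continuity on the covered one. -/
theorem exists_continuous_comp_of_continuous_comp {V : Type w} [AddCommGroup V] [Module ℂ V]
    [TopologicalSpace V] [T2Space V] {F : Type u} [NormedAddCommGroup F] [NormedSpace ℂ F] [CompleteSpace F]
    {G : ℕ → Type v} [∀ k, NormedAddCommGroup (G k)] [∀ k, NormedSpace ℂ (G k)]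
    [∀ k, CompleteSpace (G k)] {a : F →ₗ[ℂ] V} (ha : Continuous a) {b : ∀ k, G k →ₗ[ℂ] V}
    (hb : ∀ k, Continuous (b k)) (h : ∀ f, ∃ k g, b k g = a f)
    (E : Type*) [NormedAddCommGroup E] [NormedSpace ℂ E] :
    ∃ k, ∀ A : V →ₗ[ℂ] E, Continuous (A ∘ₗ b k) → Continuous (A ∘ₗ a) := by
  obtain ⟨k, C, hC⟩ := exists_lift_norm_le ha hb h
  refine ⟨k, fun A hA => ?_⟩
  let B : G k →L[ℂ] E := ⟨A ∘ₗ b k, hA⟩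
  refine AddMonoidHomClass.continuous_of_bound (A ∘ₗ a) (‖B‖ * C) fun f => ?_
  obtain ⟨g, hg, hgC⟩ := hC f
  have : (A ∘ₗ a) f = B g := by simp [B, hg]
  rw [this, mul_assoc]
  exact (B.le_opNorm g).trans (by gcongr)

/-! ### Seminorms, weak topologies and maps into `ℓ^∞(I)` -/

open scoped ComplexOrder in
theorem polynormableSpace_of_locallyConvexSpace_real (V : Type*) [AddCommGroup V] [Module ℂ V]
    [TopologicalSpace V] [IsTopologicalAddGroup V] [ContinuousSMul ℂ V] [LocallyConvexSpace ℝ V] :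
    PolynormableSpace ℂ V := by
  have : LocallyConvexSpace ℂ V :=
    .ofBasisZero ℂ V _ _ (LocallyConvexSpace.convex_basis_zero ℝ V) fun _ hs =>
      convex_of_nonneg_surjective_algebraMap (R := ℝ) ℂ
        (fun _ hc => RCLike.nonneg_iff_exists_ofReal.mp hc) hs.2
  have : ContinuousSMul ℝ V := IsScalarTower.continuousSMul ℂ
  infer_instance

theorem WeakSpace.polynormableSpace (V : Type*) [AddCommGroup V] [Module ℂ V]
    [TopologicalSpace V] : PolynormableSpace ℂ (WeakSpace ℂ V) :=
  (LinearMap.weakBilin_withSeminorms (topDualPairing ℂ V).flip).toPolynormableSpace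

theorem WeakSpace.continuous_strongDual {V : Type*} [AddCommGroup V] [Module ℂ V]
    [TopologicalSpace V] (f : V →L[ℂ] ℂ) :
    Continuous fun x : WeakSpace ℂ V => f ((toWeakSpace ℂ V).symm x) :=
  WeakBilin.eval_continuous (topDualPairing ℂ V).flip f

theorem Seminorm.continuous_of_norm_le {V E : Type*} [AddCommGroup V] [Module ℂ V]
    [TopologicalSpace V] [PolynormableSpace ℂ V] [NormedAddCommGroup E] [NormedSpace ℂ E]
    {p : Seminorm ℂ V} (hp : Continuous p) (f : V →ₗ[ℂ] E) (h : ∀ x, ‖f x‖ ≤ p x) :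
    Continuous f :=
  (PolynormableSpace.withSeminorms ℂ V).continuous_normedSpace_rng E f
    ⟨{⟨p, hp⟩}, 1, fun x => by simpa using h x⟩

/-- The linear map into `ℓ^∞(I)` whose coordinates are the given linear functionals, which are
bounded by one seminorm. -/
noncomputable def EllInfty.ofSeminorm {I : Type u} {V : Type*} [AddCommGroup V] [Module ℂ V]
    (p : Seminorm ℂ V) (φ : I → V →ₗ[ℂ] ℂ) (h : ∀ i x, ‖φ i x‖ ≤ p x) : V →ₗ[ℂ] EllInfty I where
  toFun x := ⟨fun i => φ i x, memℓp_infty ⟨p x, by rintro _ ⟨i, rfl⟩; exact h i x⟩⟩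
  map_add' x y := by ext i; exact map_add (φ i) x y
  map_smul' c x := by ext i; exact map_smul (φ i) c x

theorem EllInfty.norm_ofSeminorm_le {I : Type u} {V : Type*} [AddCommGroup V] [Module ℂ V]
    (p : Seminorm ℂ V) (φ : I → V →ₗ[ℂ] ℂ) (h : ∀ i x, ‖φ i x‖ ≤ p x) (x : V) :
    ‖EllInfty.ofSeminorm p φ h x‖ ≤ p x :=
  lp.norm_le_of_forall_le (apply_nonneg p x) fun i => h i x

/-- Continuous linear maps into `ℓ^∞(I)` extend along topological embeddings of locally convex
spaces. -/
theorem EllInfty.exists_comp_eq_of_isEmbedding {I : Type u} {V W : Type*} [AddCommGroup V]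
    [Module ℂ V] [TopologicalSpace V] [AddCommGroup W] [Module ℂ W] [TopologicalSpace W]
    [PolynormableSpace ℂ W] {e : V →ₗ[ℂ] W} (he : Topology.IsEmbedding e) (T : V →L[ℂ] EllInfty I) :
    ∃ R : W →L[ℂ] EllInfty I, ∀ x, R (e x) = T x := by
  obtain ⟨p, hp, hle⟩ := Seminorm.exists_le_comp_of_isInducing
    (p := (normSeminorm ℂ (EllInfty I)).comp (T : V →ₗ[ℂ] EllInfty I)) T.continuous.norm
    he.isInducing
  let e' := LinearEquiv.ofInjective e he.injective
  have he' : ∀ x, e'.symm ⟨e x, x, rfl⟩ = x := fun x => e'.symm_apply_apply x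
  have hT : ∀ x, ‖T x‖ ≤ p (e x) := hle
  have hcoord : ∀ i, ∃ g : W →ₗ[ℂ] ℂ, (∀ x, g (e x) = T x i) ∧ ∀ y, ‖g y‖ ≤ p y := fun i => by
    let f : LinearMap.range e →ₗ[ℂ] ℂ :=
      { toFun y := T (e'.symm y) i
        map_add' x y := by simp
        map_smul' c x := by simp }
    obtain ⟨g, hg, hgp⟩ := Module.Dual.exists_extension_of_le_seminorm (LinearMap.range e) f
      (p := p) <| by
        rintro ⟨_, x, rfl⟩
        refine (lp.norm_apply_le_norm ENNReal.top_ne_zero _ i).trans ?_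
        rw [he']
        exact hT x
    refine ⟨g, fun x => ?_, hgp⟩
    rw [hg ⟨e x, x, rfl⟩]
    change T (e'.symm ⟨e x, x, rfl⟩) i = _
    rw [he']
  choose g hg hgp using hcoord
  refine ⟨⟨EllInfty.ofSeminorm p g hgp, Seminorm.continuous_of_norm_le hp _
    (EllInfty.norm_ofSeminorm_le p g hgp)⟩, fun x => ?_⟩
  ext i
  exact hg i x

/-- Continuous seminorms are detected by maps into `ℓ^∞`. -/
theorem EllInfty.exists_norm_eq_seminorm {V : Type u} [AddCommGroup V] [Module ℂ V]
    [TopologicalSpace V] [PolynormableSpace ℂ V] {p : Seminorm ℂ V} (hp : Continuous p) :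
    ∃ (I : Type u) (T : V →L[ℂ] EllInfty I), ∀ x, ‖T x‖ = p x := by
  -- The index set is the polar of the unit ball of `p`; Hahn-Banach provides a member attaining `p
  -- x` at `x`.
  let I := {f : V →ₗ[ℂ] ℂ // ∀ x, ‖f x‖ ≤ p x}
  let T : V →ₗ[ℂ] EllInfty I := EllInfty.ofSeminorm p (fun f => f.1) fun f => f.2
  have hT : ∀ x, ‖T x‖ ≤ p x := EllInfty.norm_ofSeminorm_le _ _ _
  refine ⟨I, ⟨T, Seminorm.continuous_of_norm_le hp T hT⟩, fun x => le_antisymm (hT x) ?_⟩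
  rcases eq_or_ne x 0 with rfl | hx
  · simp
  let f : ℂ ∙ x →ₗ[ℂ] ℂ := (p x : ℂ) • (LinearEquiv.coord ℂ V x hx : ℂ ∙ x →ₗ[ℂ] ℂ)
  obtain ⟨g, hg, hgp⟩ := Module.Dual.exists_extension_of_le_seminorm (ℂ ∙ x) f (p := p) <| by
    rintro ⟨y, hy⟩
    obtain ⟨c, rfl⟩ := Submodule.mem_span_singleton.1 hy
    have : LinearEquiv.coord ℂ V x hx ⟨c • x, hy⟩ = c := by
      rw [show (⟨c • x, hy⟩ : ℂ ∙ x) = c • ⟨x, Submodule.mem_span_singleton_self x⟩ from rfl,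
        map_smul, LinearEquiv.coord_self]
      simp
    simp [f, this, map_smul_eq_mul, mul_comm, abs_of_nonneg (apply_nonneg p x)]
  have hgx : g x = p x := by
    rw [hg ⟨x, Submodule.mem_span_singleton_self x⟩]
    simp [f, LinearEquiv.coord_self]
  calc p x = ‖T x ⟨g, hgp⟩‖ := by
        change p x = ‖g x‖
        rw [hgx, Complex.norm_real, Real.norm_of_nonneg (apply_nonneg p x)]
    _ ≤ ‖T x‖ := lp.norm_apply_le_norm ENNReal.top_ne_zero _ _

theorem LinearMap.exists_comp_eq_of_ker_le_ker {V W E : Type*} [AddCommGroup V] [Module ℂ V]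
    [AddCommGroup W] [Module ℂ W] [AddCommGroup E] [Module ℂ E] (f : V →ₗ[ℂ] W) (g : V →ₗ[ℂ] E)
    (h : ∀ x, f x = 0 → g x = 0) : ∃ B : W →ₗ[ℂ] E, ∀ x, B (f x) = g x := by
  obtain ⟨B, hB⟩ := LinearMap.exists_extend
    ((LinearMap.ker f).liftQ g h ∘ₗ f.quotKerEquivRange.symm.toLinearMap)
  refine ⟨B, fun x => (LinearMap.congr_fun hB ⟨f x, x, rfl⟩).trans ?_⟩
  rw [LinearMap.comp_apply, LinearEquiv.coe_coe, f.quotKerEquivRange_symm_apply_image x ⟨x, rfl⟩]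
  exact Submodule.liftQ_apply _ _ _

/-! ### Universal properties of inductive limits and direct sums -/

section finestLCTopology

variable {ι : Type w} {V : Type u} [AddCommGroup V] [Module ℂ V] {F : ι → Type v}
  [∀ i, AddCommGroup (F i)] [∀ i, Module ℂ (F i)] [∀ i, TopologicalSpace (F i)]
  (j : ∀ i, F i →ₗ[ℂ] V)

/-- The universal property of the finest locally convex topology. -/
theorem continuous_finestLCTopology {W : Type*} [AddCommGroup W] [Module ℂ W]
    [t : TopologicalSpace W] [IsTopologicalAddGroup W] [ContinuousSMul ℂ W] [LocallyConvexSpace ℝ W]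
    (f : V →ₗ[ℂ] W) (hf : ∀ i, Continuous (f ∘ₗ j i)) :
    @Continuous V W (finestLCTopology j) t f := by
  rw [continuous_iff_le_induced]
  refine (finestLCTopology_isLeast j).2 ⟨topologicalAddGroup_induced f,
    continuousSMul_induced f, LocallyConvexSpace.induced (f.restrictScalars ℝ), fun i => ?_⟩
  exact continuous_induced_rng.2 (hf i)

end finestLCTopology

namespace BanachSpectrum

variable {X : Type u} [AddCommGroup X] [Module ℂ X] (S : BanachSpectrum X)

section IsInd

variable {S} [t : TopologicalSpace X] (hS : S.IsInd)
include hS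

theorem IsInd.isLeast :
    IsLeast {t | @IsTopologicalAddGroup X t _ ∧ @ContinuousSMul ℂ X _ _ t ∧
      @LocallyConvexSpace ℝ X _ _ _ _ t ∧ ∀ n, @Continuous _ _ _ t (S.incl n)} t := by
  have h := finestLCTopology_isLeast S.incl
  rwa [← show t = finestLCTopology S.incl from hS] at h

theorem IsInd.isTopologicalAddGroup : IsTopologicalAddGroup X := hS.isLeast.1.1

theorem IsInd.continuousSMul : ContinuousSMul ℂ X := hS.isLeast.1.2.1

theorem IsInd.locallyConvexSpace : LocallyConvexSpace ℝ X := hS.isLeast.1.2.2.1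

theorem IsInd.continuous_incl (n : ℕ) : Continuous (S.incl n) := hS.isLeast.1.2.2.2 n

theorem IsInd.continuous {W : Type*} [AddCommGroup W] [Module ℂ W] [TopologicalSpace W]
    [IsTopologicalAddGroup W] [ContinuousSMul ℂ W] [LocallyConvexSpace ℝ W] (f : X →ₗ[ℂ] W)
    (hf : ∀ n, Continuous (f ∘ₗ S.incl n)) : Continuous f := by
  have h := continuous_finestLCTopology S.incl f hf
  rwa [← show t = finestLCTopology S.incl from hS] at h

theorem IsInd.continuous_of_normedSpace {E : Type*} [NormedAddCommGroup E] [NormedSpace ℂ E]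
    (f : X →ₗ[ℂ] E) (hf : ∀ n, Continuous (f ∘ₗ S.incl n)) : Continuous f :=
  hS.continuous f hf

end IsInd

instance : IsTopologicalAddGroup S.DSum := (finestLCTopology_isLeast S.single).1.1

instance : ContinuousSMul ℂ S.DSum := (finestLCTopology_isLeast S.single).1.2.1

instance : LocallyConvexSpace ℝ S.DSum := (finestLCTopology_isLeast S.single).1.2.2.1

instance : PolynormableSpace ℂ S.DSum := polynormableSpace_of_locallyConvexSpace_real _

theorem continuous_single (n : ℕ) : Continuous (S.single n) :=
  (finestLCTopology_isLeast S.single).1.2.2.2 n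

theorem continuous_dSum {W : Type*} [AddCommGroup W] [Module ℂ W] [TopologicalSpace W]
    [IsTopologicalAddGroup W] [ContinuousSMul ℂ W] [LocallyConvexSpace ℝ W] (f : S.DSum →ₗ[ℂ] W)
    (hf : ∀ n, Continuous (f ∘ₗ S.single n)) : Continuous f :=
  continuous_finestLCTopology S.single f hf

/-- The linear map on the direct sum given by its restrictions to the summands. -/
noncomputable def desc {V : Type*} [AddCommGroup V] [Module ℂ V] (f : ∀ n, S.space n →ₗ[ℂ] V) :
    S.DSum →ₗ[ℂ] V :=
  DirectSum.toModule ℂ ℕ V f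

@[simp]
theorem desc_single {V : Type*} [AddCommGroup V] [Module ℂ V] (f : ∀ n, S.space n →ₗ[ℂ] V) (n : ℕ)
    (y : S.space n) : S.desc f (S.single n y) = f n y :=
  DirectSum.toModule_lof ℂ n y

theorem d_single (n : ℕ) (y : S.space n) :
    S.d (S.single n y) = S.single n y - S.single (n + 1) (S.link n y) := by
  simp [d, shift_single]

theorem ext_coord {x y : S.DSum} (h : ∀ n, S.coord n x = S.coord n y) : x = y :=
  DFinsupp.ext h

theorem dSum_induction {motive : S.DSum → Prop} (zero : motive 0)
    (single : ∀ n y, motive (S.single n y))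
    (add : ∀ x y, motive x → motive y → motive (x + y)) (x : S.DSum) : motive x :=
  DirectSum.induction_on x zero single add

theorem d_injective : Function.Injective S.d := by
  refine (injective_iff_map_eq_zero _).2 fun x hx => S.ext_coord fun n => ?_
  rw [map_zero]
  induction n with
  | zero => rw [← coord_zero_d, hx, map_zero]
  | succ n ih =>
    have := S.coord_succ_d x n
    rwa [hx, ih, map_zero, map_zero, sub_zero, eq_comm] at this

theorem continuous_d : Continuous S.d :=
  S.continuous_dSum _ fun n => by
    have : S.d ∘ₗ S.single n = S.single n - S.single (n + 1) ∘ₗ (S.link n : S.space n →ₗ[ℂ] _) :=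
      LinearMap.ext fun y => S.d_single n y
    rw [this]
    exact (S.continuous_single n).sub ((S.continuous_single (n + 1)).comp (S.link n).continuous)

theorem continuous_coord (n : ℕ) : Continuous (S.coord n) :=
  S.continuous_dSum _ fun m => by
    by_cases h : m = n
    · subst h
      refine continuous_id.congr fun y => ?_
      simp [coord_single_self]
    · refine continuous_zero.congr fun y => ?_
      simp [coord_single_of_ne _ h]

instance : T2Space S.DSum :=
  .of_injective_continuous (f := fun x n => S.coord n x)
    (fun _ _ h => S.ext_coord fun n => congrFun h n) (continuous_pi S.continuous_coord)

/-! ### The canonical resolution of an inductive limit -/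

/-- The sum map from the direct sum onto the union. -/
noncomputable def sumMap : S.DSum →ₗ[ℂ] X :=
  S.desc S.incl

@[simp]
theorem sumMap_single (n : ℕ) (y : S.space n) : S.sumMap (S.single n y) = S.incl n y :=
  S.desc_single _ n y

theorem sumMap_surjective : Function.Surjective S.sumMap := fun x => by
  obtain ⟨n, y, rfl⟩ := S.exists_incl_eq x
  exact ⟨S.single n y, S.sumMap_single n y⟩

theorem sumMap_d (x : S.DSum) : S.sumMap (S.d x) = 0 := by
  have : S.sumMap ∘ₗ S.d = 0 := S.hom_ext fun n y => by simp [d_single, incl_link]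
  exact LinearMap.congr_fun this x

theorem exists_single_add_d_of_le {m n : ℕ} (h : m ≤ n) (y : S.space m) :
    ∃ z w, S.single m y = S.single n z + S.d w := by
  induction n, h using Nat.le_induction with
  | base => exact ⟨y, 0, by simp⟩
  | succ n _ ih =>
    obtain ⟨z, w, hzw⟩ := ih
    refine ⟨S.link n z, w + S.single n z, ?_⟩
    rw [hzw, map_add, d_single]
    abel

/-- Modulo the range of `d`, every summand can be pushed to a common later step. Exactness follows,
since `incl n` is injective. -/
theorem exists_eq_single_add_d (x : S.DSum) : ∃ n z w, x = S.single n z + S.d w := by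
  induction x using S.dSum_induction with
  | zero => exact ⟨0, 0, 0, by simp⟩
  | single n y => exact ⟨n, y, 0, by rw [map_zero, add_zero]⟩
  | add x x' hx hx' =>
    obtain ⟨n, z, w, rfl⟩ := hx
    obtain ⟨n', z', w', rfl⟩ := hx'
    obtain ⟨a, b, h⟩ := S.exists_single_add_d_of_le (le_max_left n n') z
    obtain ⟨a', b', h'⟩ := S.exists_single_add_d_of_le (le_max_right n n') z'
    refine ⟨max n n', a + a', b + b' + w + w', ?_⟩
    rw [h, h']
    simp only [map_add]
    abel

theorem exact_d_sumMap : Function.Exact S.d S.sumMap := fun x => by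
  refine ⟨fun hx => ?_, ?_⟩
  · obtain ⟨n, z, w, rfl⟩ := S.exists_eq_single_add_d x
    rw [map_add, sumMap_d, add_zero, sumMap_single] at hx
    rw [(injective_iff_map_eq_zero _).1 (S.incl_injective n) z hx, map_zero, zero_add]
    exact ⟨w, rfl⟩
  · rintro ⟨y, rfl⟩
    exact S.sumMap_d y

/-- The spectrum of the finite partial sums of the direct sum. -/
noncomputable def partialSums : BanachSpectrum S.DSum where
  space n := ∀ i : Fin (n + 1), S.space i
  incl n := ∑ i : Fin (n + 1), S.single i ∘ₗ LinearMap.proj i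
  incl_injective n := by
    refine (injective_iff_map_eq_zero _).2 fun x hx => funext fun i => ?_
    have h : S.coord i ((∑ j : Fin (n + 1), S.single j ∘ₗ LinearMap.proj j) x) = x i := by
      simp only [LinearMap.sum_apply, LinearMap.comp_apply, LinearMap.proj_apply, map_sum]
      rw [Finset.sum_eq_single i (fun j _ hj => S.coord_single_of_ne (by omega) _) (by simp),
        coord_single_self]
    rw [← h, hx, map_zero]
    rfl
  link n := ContinuousLinearMap.pi fun i : Fin (n + 1 + 1) =>
    if h : i.1 < n + 1 then
      ContinuousLinearMap.proj (R := ℂ) (φ := fun j : Fin (n + 1) => S.space j) ⟨i.1, h⟩ else 0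
  incl_link n x := by
    rw [Fin.sum_univ_castSucc]
    simp only [LinearMap.add_apply, LinearMap.sum_apply, LinearMap.comp_apply,
      LinearMap.proj_apply, ContinuousLinearMap.pi_apply, Fin.val_castSucc, Fin.val_last,
      lt_irrefl, Fin.is_lt, dite_true, dite_false, _root_.zero_apply, map_zero,
      add_zero, ContinuousLinearMap.proj_apply]
  exists_incl_eq x := by
    -- Strengthened to all later steps so that two elements can be added in a common one.
    suffices h : ∃ n, ∀ m ≥ n, ∃ y : ∀ i : Fin (m + 1), S.space i,
        (∑ i : Fin (m + 1), S.single i ∘ₗ LinearMap.proj i :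
          (∀ i : Fin (m + 1), S.space i) →ₗ[ℂ] S.DSum) y = x by
      obtain ⟨n, hn⟩ := h
      exact ⟨n, hn n le_rfl⟩
    induction x using S.dSum_induction with
    | zero => exact ⟨0, fun m _ => ⟨0, map_zero _⟩⟩
    | single n y =>
      refine ⟨n, fun m hm => ⟨Pi.single (⟨n, by omega⟩ : Fin (m + 1)) y, ?_⟩⟩
      simp only [LinearMap.sum_apply, LinearMap.comp_apply, LinearMap.proj_apply]
      rw [Finset.sum_eq_single ⟨n, by omega⟩ (fun j _ hj => by rw [Pi.single_eq_of_ne hj, map_zero])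
        (by simp), Pi.single_eq_same]
    | add x x' hx hx' =>
      obtain ⟨n, hn⟩ := hx
      obtain ⟨n', hn'⟩ := hx'
      refine ⟨max n n', fun m hm => ?_⟩
      obtain ⟨y, hy⟩ := hn m (by omega)
      obtain ⟨y', hy'⟩ := hn' m (by omega)
      exact ⟨y + y', by rw [map_add, hy, hy']⟩

theorem partialSums_incl_apply (n : ℕ) (x : ∀ i : Fin (n + 1), S.space i) :
    S.partialSums.incl n x = ∑ i : Fin (n + 1), S.single i (x i) := by
  change (∑ i : Fin (n + 1), S.single i ∘ₗ LinearMap.proj i :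
    (∀ i : Fin (n + 1), S.space i) →ₗ[ℂ] S.DSum) x = _
  simp

/-- A vector space topology makes all finite partial sums continuous iff it makes all single
summands continuous, so both infima run over the same set. -/
theorem isInd_partialSums : S.partialSums.IsInd := by
  refine congrArg sInf (Set.ext fun t => and_congr_right fun h₁ => and_congr_right fun h₂ =>
    and_congr_right fun h₃ => ⟨fun h n => ?_, fun h n => ?_⟩)
  · have : Continuous fun x : ∀ i : Fin (n + 1), S.space i =>
        ∑ i : Fin (n + 1), S.single i (x i) :=
      continuous_finsetSum _ fun i _ => (h i).comp (continuous_apply i)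
    exact this.congr fun x => (S.partialSums_incl_apply n x).symm
  · have : ⇑(S.single n) = fun y : S.space n => S.partialSums.incl n
        (Pi.single (M := fun i : Fin (n + 1) => S.space i) (Fin.last n) y) := by
      ext y
      rw [partialSums_incl_apply, Finset.sum_eq_single (Fin.last n)
        (fun j _ hj => by rw [Pi.single_eq_of_ne hj, map_zero]) (by simp), Pi.single_eq_same]
      rfl
    rw [this]
    exact (h n).comp
      (_root_.continuous_single (A := fun i : Fin (n + 1) => S.space i) (Fin.last n))

theorem isLBSpace_dSum : IsLBSpace S.DSum :=
  ⟨inferInstance, S.partialSums, S.isInd_partialSums⟩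

/-! ### Acyclicity as factorization through `d` -/

/-- Continuous linear maps from the direct sum to `E` factor through `d`. -/
def DFactors {X : Type u} [AddCommGroup X] [Module ℂ X] (S : BanachSpectrum X) (E : Type v)
    [AddCommGroup E] [Module ℂ E] [TopologicalSpace E] : Prop :=
  ∀ T : S.DSum →L[ℂ] E, ∃ R : S.DSum →L[ℂ] E, ∀ x, R (S.d x) = T x

section

variable {X : Type u} [AddCommGroup X] [Module ℂ X] (S : BanachSpectrum X)

theorem isAcyclic_iff : S.IsAcyclic ↔ ∀ I : Type u, S.DFactors (EllInfty I) := by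
  refine ⟨fun h I T => EllInfty.exists_comp_eq_of_isEmbedding h T, fun h => ?_⟩
  refine ⟨⟨?_⟩, S.d_injective⟩
  refine IsTopologicalAddGroup.ext inferInstance (topologicalAddGroup_induced S.d) ?_
  rw [nhds_induced, map_zero]
  refine le_antisymm (Filter.map_le_iff_le_comap.1 ?_) fun U hU => ?_
  · simpa [Filter.Tendsto] using S.continuous_d.tendsto 0
  obtain ⟨s, r, hr, hrU⟩ := ((PolynormableSpace.withSeminorms ℂ S.DSum).mem_nhds_iff 0 U).1 hU
  -- With `T = R ∘ d` and `‖T x‖` the given seminorm, that seminorm is controlled by the continuous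
  -- seminorm `‖R ·‖` at `d x`.
  obtain ⟨I, T, hT⟩ := EllInfty.exists_norm_eq_seminorm
    (Seminorm.continuous_finsetSup (s := s) fun p _ => p.2)
  obtain ⟨R, hR⟩ := h I T
  refine ⟨R ⁻¹' Metric.ball 0 r, R.continuous.continuousAt.preimage_mem_nhds ?_, fun x hx => hrU ?_⟩
  · rw [map_zero]
    exact Metric.ball_mem_nhds 0 hr
  · simpa [hR, hT, Seminorm.mem_ball_zero] using hx

theorem DFactors.of_isWeaklyAcyclic (h : S.IsWeaklyAcyclic) (I : Type u) [Finite I] :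
    S.DFactors (EllInfty I) := by
  classical
  have := Fintype.ofFinite I
  have := WeakSpace.polynormableSpace S.DSum
  intro T
  let T' : WeakSpace ℂ S.DSum →L[ℂ] EllInfty I :=
    { toLinearMap := (T : S.DSum →ₗ[ℂ] EllInfty I) ∘ₗ (toWeakSpace ℂ S.DSum).symm
      cont := by
        -- Since `I` is finite, `T` is a finite sum of functionals times fixed vectors, hence weakly
        -- continuous.
        have h : ∀ x : WeakSpace ℂ S.DSum, T ((toWeakSpace ℂ S.DSum).symm x) =
            ∑ i, lp.singleContinuousLinearMap ℂ (fun _ : I => ℂ) ∞ i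
              (T ((toWeakSpace ℂ S.DSum).symm x) i) := fun x => by
          ext j
          rw [lp.coeFn_sum, Finset.sum_apply, Finset.sum_eq_single j]
          · simp
          · intro i _ hi
            simp [hi.symm]
          · simp
        refine (continuous_finsetSum _ fun i _ => ?_).congr fun x => (h x).symm
        exact (lp.singleContinuousLinearMap ℂ (fun _ : I => ℂ) ∞ i).continuous.comp
          (WeakSpace.continuous_strongDual ((lp.evalCLM ℂ (fun _ : I => ℂ) ∞ i).comp T)) }
  obtain ⟨R, hR⟩ := EllInfty.exists_comp_eq_of_isEmbedding
    (e := (toWeakSpace ℂ S.DSum).toLinearMap ∘ₗ S.d ∘ₗ (toWeakSpace ℂ S.DSum).symm.toLinearMap) h T'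
  exact ⟨R.comp (toWeakSpaceCLM ℂ S.DSum), fun x => hR (toWeakSpace ℂ S.DSum x)⟩

theorem isWeaklyAcyclic_of_dFactors {I : Type u} [Finite I] [Nonempty I]
    (h : S.DFactors (EllInfty I)) : S.IsWeaklyAcyclic := by
  classical
  obtain ⟨i⟩ := ‹Nonempty I›
  refine ⟨⟨le_antisymm ?_ ?_⟩, S.d_injective⟩
  · exact continuous_iff_le_induced.1 (WeakSpace.map ⟨S.d, S.continuous_d⟩).continuous
  · refine continuous_id_iff_le.1 ?_
    -- It suffices that each functional `f` has the form `g ∘ d` with `g` continuous: place `f` in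
    -- coordinate `i`, factor, and read that coordinate off again.
    refine @WeakBilin.continuous_of_continuous_eval _ _ _ _ _ _ _ _ _ (_) _ (_) _ fun f => ?_
    obtain ⟨R, hR⟩ := h ((lp.singleContinuousLinearMap ℂ (fun _ : I => ℂ) ∞ i).comp f)
    have hf : ∀ x, (lp.evalCLM ℂ (fun _ : I => ℂ) ∞ i).comp R (S.d x) = f x := fun x => by
      change R (S.d x) i = f x
      rw [hR]
      simp
    refine @Continuous.congr _ _ (_) _ _ _ ?_ hf
    exact @Continuous.comp (WeakSpace ℂ S.DSum) (WeakSpace ℂ S.DSum) ℂ (_) _ _ _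
      (fun x => (lp.evalCLM ℂ (fun _ : I => ℂ) ∞ i).comp R ((toWeakSpace ℂ S.DSum).symm x))
      (WeakSpace.continuous_strongDual ((lp.evalCLM ℂ (fun _ : I => ℂ) ∞ i).comp R))
      continuous_induced_dom

theorem exists_link_of_le {m n : ℕ} (h : m ≤ n) :
    ∃ L : S.space m →L[ℂ] S.space n, ∀ y, S.incl n (L y) = S.incl m y := by
  induction n, h using Nat.le_induction with
  | base => exact ⟨.id ℂ _, fun _ => rfl⟩
  | succ n _ ih =>
    obtain ⟨L, hL⟩ := ih
    exact ⟨(S.link n).comp L, fun y => (S.incl_link n (L y)).trans (hL y)⟩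

theorem continuous_comp_incl_of_le {E : Type*} [AddCommGroup E] [Module ℂ E] [TopologicalSpace E]
    {m n : ℕ} (h : m ≤ n) {A : X →ₗ[ℂ] E} (hA : Continuous (A ∘ₗ S.incl n)) :
    Continuous (A ∘ₗ S.incl m) := by
  obtain ⟨L, hL⟩ := S.exists_link_of_le h
  exact (hA.comp L.continuous).congr fun y => congrArg A (hL y)

/-- Factoring the differences `A n - A (n + 1)` through `d` gives continuous `R_n` with the same
differences. Hence the maps `A n - R_n` on the steps are compatible and glue to `B`, so that `A n -
B` is `R_n` on step `n`. -/
theorem DFactors.exists_continuous_sub_comp_incl {E : Type*} [NormedAddCommGroup E]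
    [NormedSpace ℂ E] (h : S.DFactors E) (A : ℕ → X →ₗ[ℂ] E)
    (hA : ∀ n, Continuous ((A n - A (n + 1)) ∘ₗ S.incl n)) :
    ∃ B : X →ₗ[ℂ] E, ∀ n, Continuous ((A n - B) ∘ₗ S.incl n) := by
  obtain ⟨R, hR⟩ := h ⟨S.desc fun n => (A n - A (n + 1)) ∘ₗ S.incl n,
    S.continuous_dSum _ fun n => (hA n).congr fun y =>
      (S.desc_single (fun n => (A n - A (n + 1)) ∘ₗ S.incl n) n y).symm⟩
  let G : S.DSum →ₗ[ℂ] E := S.desc (fun n => A n ∘ₗ S.incl n) - R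
  have hG : ∀ x, S.sumMap x = 0 → G x = 0 := fun x hx => by
    obtain ⟨x, rfl⟩ := (S.exact_d_sumMap x).1 hx
    have : G ∘ₗ S.d = 0 := S.hom_ext fun n y => by
      have h₁ : R (S.d (S.single n y)) = A n (S.incl n y) - A (n + 1) (S.incl n y) :=
        (hR _).trans (S.desc_single _ n y)
      rw [LinearMap.comp_apply, LinearMap.sub_apply, ContinuousLinearMap.coe_coe, h₁, d_single]
      simp [incl_link]
    exact LinearMap.congr_fun this x
  obtain ⟨B, hB⟩ := LinearMap.exists_comp_eq_of_ker_le_ker S.sumMap G hG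
  refine ⟨B, fun n => (R.continuous.comp (S.continuous_single n)).congr fun y => ?_⟩
  have hBy := hB (S.single n y)
  rw [sumMap_single] at hBy
  simp [hBy, G]

end

/-! ### Extension of maps along exact sequences -/

section

variable {Z : Type u} [AddCommGroup Z] [Module ℂ Z] [TopologicalSpace Z] {S : BanachSpectrum Z}

theorem IsInd.dFactors_of_isWeaklyAcyclicWrt (hS : S.IsInd) {E : Type v} [AddCommGroup E]
    [Module ℂ E] [TopologicalSpace E] (h : IsWeaklyAcyclicWrt E Z) : S.DFactors E := by
  have := hS.isTopologicalAddGroup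
  have := hS.continuousSMul
  have := hS.locallyConvexSpace
  have hsum : Continuous S.sumMap :=
    S.continuous_dSum _ fun n => (hS.continuous_incl n).congr fun y => (S.sumMap_single n y).symm
  intro T
  obtain ⟨R, hR⟩ := h S.DSum S.DSum S.isLBSpace_dSum S.isLBSpace_dSum ⟨S.d, S.continuous_d⟩
    ⟨S.sumMap, hsum⟩ S.d_injective S.exact_d_sumMap S.sumMap_surjective T
  exact ⟨R, fun x => DFunLike.congr_fun hR x⟩

theorem IsInd.isWeaklyAcyclicWrt [T2Space Z] (hS : S.IsInd) {I : Type u}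
    (h : S.DFactors (EllInfty I)) : IsWeaklyAcyclicWrt (EllInfty I) Z := by
  rintro X Y _ _ _ _ _ _ ⟨_, SX, hX⟩ ⟨_, SY, hY⟩ i Q hi hex hQ T
  -- `T'` extends `T` only algebraically. On the kernel of `Q` in each step of `Y` it is
  -- nevertheless continuous, by factorization through a step of `X`, where it equals `T`.
  obtain ⟨T', hT'⟩ := LinearMap.exists_comp_eq_of_ker_le_ker i.toLinearMap T.toLinearMap
    fun x hx => by rw [(injective_iff_map_eq_zero i).1 hi x hx, map_zero]
  have hQY : ∀ n, Continuous (Q.toLinearMap ∘ₗ SY.incl n) := fun n =>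
    Q.continuous.comp (hY.continuous_incl n)
  have hU : ∀ n, ∃ U : SY.space n →L[ℂ] EllInfty I,
      ∀ y, Q (SY.incl n y) = 0 → U y = T' (SY.incl n y) := fun n => by
    let K : Submodule ℂ (SY.space n) := LinearMap.ker (Q.toLinearMap ∘ₗ SY.incl n)
    have hK : IsClosed (K : Set (SY.space n)) := isClosed_singleton.preimage (hQY n)
    have := hK.completeSpace_coe
    obtain ⟨k, hk⟩ := exists_continuous_comp_of_continuous_comp (a := SY.incl n ∘ₗ K.subtype)
      ((hY.continuous_incl n).comp continuous_subtype_val)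
      (b := fun k => i.toLinearMap ∘ₗ SX.incl k)
      (fun k => i.continuous.comp (hX.continuous_incl k)) (fun y => by
        obtain ⟨x, hx⟩ := (hex _).1 y.2
        obtain ⟨k, g, rfl⟩ := SX.exists_incl_eq x
        exact ⟨k, g, hx⟩) (EllInfty I)
    obtain ⟨U, hU⟩ := EllInfty.exists_comp_eq_of_isEmbedding (e := K.subtype)
      Topology.IsEmbedding.subtypeVal ⟨T' ∘ₗ SY.incl n ∘ₗ K.subtype, hk T' <|
        (T.continuous.comp (hX.continuous_incl k)).congr fun x => (hT' (SX.incl k x)).symm⟩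
    exact ⟨U, fun y hy => hU ⟨y, hy⟩⟩
  choose U hU using hU
  have hA : ∀ n, ∃ A : Z →ₗ[ℂ] EllInfty I,
      ∀ y, A (Q (SY.incl n y)) = U n y - T' (SY.incl n y) := fun n =>
    LinearMap.exists_comp_eq_of_ker_le_ker (Q.toLinearMap ∘ₗ SY.incl n)
      ((U n).toLinearMap - T' ∘ₗ SY.incl n) fun y hy => sub_eq_zero.2 (hU n y hy)
  choose A hA using hA
  have hdiff : ∀ {m n : ℕ}, m ≤ n →
      Continuous (((A m - A n) ∘ₗ Q.toLinearMap) ∘ₗ SY.incl m) := fun {m n} hmn => by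
    obtain ⟨L, hL⟩ := SY.exists_link_of_le hmn
    refine ((U m).continuous.sub ((U n).continuous.comp L.continuous)).congr fun y => ?_
    have h₁ := hA m y
    have h₂ := hA n (L y)
    rw [hL] at h₂
    simp [h₁, h₂]
  -- The quotient images of the steps of `Y` and the steps of `Z` absorb each other, so continuity
  -- transfers in both directions up to a change of index.
  have hk : ∀ n, ∃ k, ∀ A : Z →ₗ[ℂ] EllInfty I,
      Continuous (A ∘ₗ Q.toLinearMap ∘ₗ SY.incl k) → Continuous (A ∘ₗ S.incl n) := fun n =>
    exists_continuous_comp_of_continuous_comp (hS.continuous_incl n) hQY (fun z => by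
      obtain ⟨y, hy⟩ := hQ (S.incl n z)
      obtain ⟨k, g, rfl⟩ := SY.exists_incl_eq y
      exact ⟨k, g, hy⟩) (EllInfty I)
  choose k hk using hk
  have hl : ∀ n, ∃ l, ∀ A : Z →ₗ[ℂ] EllInfty I,
      Continuous (A ∘ₗ S.incl l) → Continuous (A ∘ₗ Q.toLinearMap ∘ₗ SY.incl n) := fun n =>
    exists_continuous_comp_of_continuous_comp (hQY n) hS.continuous_incl (fun y =>
      S.exists_incl_eq _) (EllInfty I)
  choose l hl using hl
  -- A monotone majorant of `k`; the summand `n` ensures `n ≤ κ n`, needed to compare `A n` with a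
  -- later `A (κ m)`.
  let κ : ℕ → ℕ := fun n => ∑ j ∈ Finset.range (n + 1), k j + n
  have hkκ : ∀ n, k n ≤ κ n := fun n => by
    simp only [κ, Finset.sum_range_succ]
    omega
  have hκ : ∀ n, κ n ≤ κ (n + 1) := fun n => by
    simp only [κ, Finset.sum_range_succ _ (n + 1)]
    omega
  obtain ⟨B, hB⟩ := h.exists_continuous_sub_comp_incl S (fun n => A (κ n)) fun n =>
    hk n _ (SY.continuous_comp_incl_of_le (hkκ n) (hdiff (hκ n)))
  -- Split `A n - B` as `(A n - A (κ m)) + (A (κ m) - B)` with `m = max (l n) n`.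
  have hAB : ∀ n, Continuous ((A n - B) ∘ₗ Q.toLinearMap ∘ₗ SY.incl n) := fun n => by
    have h₁ := hl n _ (S.continuous_comp_incl_of_le (le_max_left (l n) n) (hB (max (l n) n)))
    have h₂ := hdiff (show n ≤ κ (max (l n) n) from
      (le_max_right (l n) n).trans (Nat.le_add_left _ _))
    refine (h₂.add h₁).congr fun y => ?_
    simp
  refine ⟨⟨T' + B ∘ₗ Q.toLinearMap, hY.continuous_of_normedSpace _ fun n => ?_⟩, ?_⟩
  -- On step `n`, `T' + B ∘ Q = U n - (A n - B) ∘ Q`.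
  · refine ((U n).continuous.sub (hAB n)).congr fun y => ?_
    have := hA n y
    simp [this]
    abel
  · ext1 x
    have h₁ : Q (i x) = 0 := (hex _).2 ⟨x, rfl⟩
    have h₂ : T' (i x) = T x := hT' x
    simp [h₁, h₂]

end

end BanachSpectrum

theorem mainTheorem3 (Z : Type u) [AddCommGroup Z] [Module ℂ Z] [TopologicalSpace Z] [T2Space Z]
    (S : BanachSpectrum Z) (hS : S.IsInd) :
    (S.IsAcyclic ↔ ∀ I : Type u, IsWeaklyAcyclicWrt (EllInfty I) Z) ∧
    (S.IsWeaklyAcyclic ↔ ∀ I : Type u, Finite I → IsWeaklyAcyclicWrt (EllInfty I) Z) ∧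
    (S.IsWeaklyAcyclic ↔
      ∃ I : Type u, Finite I ∧ Nonempty I ∧ IsWeaklyAcyclicWrt (EllInfty I) Z) := by
  have hall : S.IsWeaklyAcyclic → ∀ I : Type u, Finite I → IsWeaklyAcyclicWrt (EllInfty I) Z :=
    fun h I _ => hS.isWeaklyAcyclicWrt (.of_isWeaklyAcyclic S h I)
  have hex : (∃ I : Type u, Finite I ∧ Nonempty I ∧ IsWeaklyAcyclicWrt (EllInfty I) Z) →
      S.IsWeaklyAcyclic := by
    rintro ⟨I, _, _, h⟩
    exact S.isWeaklyAcyclic_of_dFactors (hS.dFactors_of_isWeaklyAcyclicWrt h)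
  refine ⟨?_, ⟨hall, fun h => hex ⟨PUnit, inferInstance, inferInstance, h _ inferInstance⟩⟩,
    ⟨fun h => ⟨PUnit, inferInstance, inferInstance, hall h _ inferInstance⟩, hex⟩⟩
  rw [S.isAcyclic_iff]
  exact ⟨fun h I => hS.isWeaklyAcyclicWrt (h I),
    fun h I => hS.dFactors_of_isWeaklyAcyclicWrt (h I)⟩
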